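/- Let $k$ be a field, $Q$ a finite quiver, $R=kQ$ its path algebra (paths are composed from left to right), $I\subseteq R$ an ideal, and let $\Lambda=R/I$ be Koszul. Let $\{f^n_i\}_{0\le i\le t_n}$, $n\ge 0$, be uniform elements of $R$, homogeneous of degree $n$, with origins $o(f^n_i)$ and termini $t(f^n_i)$, that define a minimal linear resolution of $\Lambda_0$ by right $\Lambda$-modules: the $f^0_i$ are the vertices, the $f^1_i$ the arrows, the $f^2_i$ generate $I$, the sums $\bigoplus_i f^n_iR$ are direct with $f^n_iR\cong t(f^n_i)R$, and the modules $\bigoplus_i f^n_iR/\bigoplus_i f^n_iI$, with the maps induced by the inclusions $\bigoplus_i f^{n+1}_iR\subseteq\bigoplus_i f^{n}_iR$, form an exact resolution of $\Lambda_0$. Let $c_{pq}(n,i,v)\in k$ be scalars with $$f^n_i=\sum_{p=0}^{t_v}\sum_{q=0}^{t_{n-v}}c_{pq}(n,i,v)\,f^v_pf^{n-v}_q\qquad(0\le v\le n,\ 0\le i\le t_n).$$ (Symbols $c_{pq}(n,i,v)$ that occur below with $i>t_n$ may have arbitrary values, e.g. $0$.) Let $\mathbb K$ be the complex of $\Lambda^e$-modules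 $\mathbb K_n=\bigoplus_i\Lambda o(f^n_i)\otimes_k t(f^n_i)\Lambda$ with generators $\varepsilon^n_i=o(f^n_i)\otimes t(f^n_i)$, differential $$d(\varepsilon^n_i)=\sum_j\Big(\sum_p c_{pj}(n,i,1)f^1_p\varepsilon^{n-1}_j+(-1)^n\sum_q c_{jq}(n,i,n-1)\varepsilon^{n-1}_jf^1_q\Big),$$ augmentation $\mu:\mathbb K_0\to\Lambda$ given by multiplication, and diagonal map $\Delta:\mathbb K\to\mathbb K\otimes_\Lambda\mathbb K$, $\Delta(\varepsilon^n_i)=\sum_{v=0}^n\sum_{p,q}c_{pq}(n,i,v)\,\varepsilon^v_p\otimes\varepsilon^{n-v}_q$. A homotopy lifting of a cocycle $\eta:\mathbb K_n\to\Lambda$ is a $\Lambda^e$-linear map $\psi_\eta:\mathbb K\to\mathbb K[1-n]$ (with components $\mathbb K_m\to\mathbb K_{m-n+1}$) such that $$d\psi_\eta-(-1)^{n-1}\psi_\eta d=(\eta\otimes1-1\otimes\eta)\Delta$$ and such that $\mu\psi_\eta-(-1)^{n-1}\eta\varphi$ is a coboundary for some $\varphi:\mathbb K\to\mathbb K[1]$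 with $d\varphi+\varphi d=(\mu\otimes1-1\otimes\mu)\Delta$. Here $(1\otimes\eta)(x\otimes y)=(-1)^{nl}x\,\eta(y)$ for $x\in\mathbb K_l$, $y\in\mathbb K_n$. Let $\eta:\mathbb K_n\to\Lambda$ be a cocycle with $\eta(\varepsilon^n_i)=f^1_w$ for some $i$ and some $w$, and $\eta(\varepsilon^n_j)=0$ for $j\ne i$. For all $m$ and $0\le r\le t_m$ let $s=s(m,r)$ be an index and let $b_{m,r}(m-n+1,j)$ be scalars that vanish for $j\neq s(m,r)$. Suppose that $b_{m,r}(m-n+1,s)\ne0$ only if $s\le t_{m-n+1}$ and $f^m_r$, $f^{m-n+1}_s$ have the same origin and the same terminus (so that the map $\psi_\eta$ below is well defined), and that $b_{n-1,r}(0,j)=0$ for all $r$ and $j$. Suppose further that, for all $m\ge n$ and $0\le r\le t_m$: (C) for all $j$ with $b_{m-1,j}(m-n,j')\ne0$, where $j'=s(m-1,j)$, and all $p$, $q$, $$c_{pj}(m,r,1)=c_{pj'}(m-n+1,r,1),\qquad(-1)^mc_{jq}(m,r,m-1)=(-1)^{m-n+1}c_{j'q}(m-n+1,r,m-n);$$ (i)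 for all $0\le\alpha\le t_{m-n}$ and $0\le p\le t_1$, with $s=s(m,r)$, $$b_{m,r}(m-n+1,s)\,c_{p\alpha}(m-n+1,s,1)+(-1)^n\Big(\sum_{j=0}^{t_{m-1}}b_{m-1,j}(m-n,\alpha)\Big)c_{p\alpha}(m-n+1,r,1)=\begin{cases}c_{i\alpha}(m,r,n)&p=w\\0&p\ne w;\end{cases}$$ (ii) for all $0\le\alpha\le t_{m-n}$ and $0\le q\le t_1$, with $s=s(m,r)$, $$(-1)^{m+1}\Big[(-1)^nb_{m,r}(m-n+1,s)\,c_{\alpha q}(m-n+1,s,m-n)+\Big(\sum_{j=0}^{t_{m-1}}b_{m-1,j}(m-n,\alpha)\Big)c_{\alpha q}(m-n+1,r,m-n)\Big]=\begin{cases}(-1)^{n(m-n)+1}c_{\alpha i}(m,r,m-n)&q=w\\0&q\ne w.\end{cases}$$ (For $m=n=0$ the sums over $j$ are empty.) Then the $\Lambda^e$-linear map with $$\psi_\eta(\varepsilon^m_r)=b_{m,r}(m-n+1,s)\,\varepsilon^{m-n+1}_s,\qquad s=s(m,r),$$ for all $m$ and $r$ exists and is a homotopy lifting of $\eta$ with respect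 to $\Delta$. -/

import Mathlib

open scoped TensorProduct

noncomputable section

namespace KoszulLift

/-! ### Path algebras -/

/-- The paths of a quiver (of any length `≥ 0`), with origin and terminus. -/
abbrev PathOf (V : Type*) [Quiver V] := Σ a : V, Σ b : V, Quiver.Path a b

open Classical in
/-- Concatenation from left to right: `p q` is defined when the terminus of `p` is the
origin of `q`. -/
def concat {V : Type*} [Quiver V] (p q : PathOf V) : Option (PathOf V) :=
  if h : p.2.1 = q.1 then some ⟨p.1, q.2.1, p.2.2.comp (q.2.2.cast h.symm rfl)⟩ else none

/-- The path algebra `kQ`: the vector space with basis all paths. -/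
def PathAlgebra (k V : Type*) [Field k] [Quiver V] := PathOf V →₀ k

namespace PathAlgebra

variable {k V : Type*} [Field k] [Quiver V]

instance : AddCommGroup (PathAlgebra k V) := inferInstanceAs (AddCommGroup (PathOf V →₀ k))
instance : Module k (PathAlgebra k V) := inferInstanceAs (Module k (PathOf V →₀ k))

/-- The basis element given by a path, and `0` for an undefined concatenation. -/
def ofOption : Option (PathOf V) → PathAlgebra k V
  | none => 0
  | some p => Finsupp.single p (1 : k)

variable (k) in
/-- A path as an element of the path algebra. -/
def ofPath {a b : V} (p : Quiver.Path a b) : PathAlgebra k V :=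
  Finsupp.single (⟨a, b, p⟩ : PathOf V) (1 : k)

variable (k) in
/-- The idempotent `e_v` of a vertex. -/
def vertex (v : V) : PathAlgebra k V := ofPath k (Quiver.Path.nil : Quiver.Path v v)

/-- Multiplication: the bilinear extension of concatenation. -/
def mulBilin : PathAlgebra k V →ₗ[k] PathAlgebra k V →ₗ[k] PathAlgebra k V :=
  Finsupp.lift (PathAlgebra k V →ₗ[k] PathAlgebra k V) k (PathOf V) fun p =>
    Finsupp.lift (PathAlgebra k V) k (PathOf V) fun q => ofOption (concat p q)

instance : Mul (PathAlgebra k V) := ⟨fun x y => mulBilin x y⟩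

instance [Fintype V] : One (PathAlgebra k V) := ⟨∑ v, vertex k v⟩

theorem mul_def (x y : PathAlgebra k V) : x * y = mulBilin x y := rfl

theorem lift_single {M : Type*} [AddCommGroup M] [Module k M] (f : PathOf V → M)
    (p : PathOf V) :
    Finsupp.lift M k (PathOf V) f (Finsupp.single p (1 : k)) = f p := by
  simp

theorem mul_eq_ofOption {a b c d : V} (p : Quiver.Path a b) (q : Quiver.Path c d) :
    ofPath k p * ofPath k q = ofOption (concat ⟨a, b, p⟩ ⟨c, d, q⟩) :=
  (LinearMap.congr_fun (lift_single _ (⟨a, b, p⟩ : PathOf V)) _).trans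
    (lift_single _ (⟨c, d, q⟩ : PathOf V))

theorem ofPath_mul_ofPath {a b c : V} (p : Quiver.Path a b) (q : Quiver.Path b c) :
    ofPath k p * ofPath k q = ofPath k (p.comp q) := by
  rw [mul_eq_ofOption]
  simp only [ofPath, ofOption, concat, dite_true, Quiver.Path.cast_rfl_rfl]
  rfl

theorem ofPath_mul_ofPath_of_ne {a b c d : V} (p : Quiver.Path a b) (q : Quiver.Path c d)
    (h : b ≠ c) : ofPath k p * ofPath k q = 0 := by
  rw [mul_eq_ofOption]; simp [ofOption, concat, h]

/-- Linear maps out of the path algebra that agree on paths are equal. -/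
theorem hom_ext {M : Type*} [AddCommGroup M] [Module k M] {f g : PathAlgebra k V →ₗ[k] M}
    (h : ∀ (a b : V) (p : Quiver.Path a b), f (ofPath k p) = g (ofPath k p)) : f = g :=
  Finsupp.lhom_ext' fun p => LinearMap.ext_ring (h p.1 p.2.1 p.2.2)

theorem zero_mul' (x : PathAlgebra k V) : 0 * x = 0 := LinearMap.map_zero₂ mulBilin x

theorem mul_zero' (x : PathAlgebra k V) : x * 0 = 0 := map_zero (mulBilin x)

theorem mul_assoc' (x y z : PathAlgebra k V) : x * y * z = x * (y * z) := by
  have h1 : ∀ (a b : V) (p : Quiver.Path a b) (c d : V) (q : Quiver.Path c d)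
      (z : PathAlgebra k V), ofPath k p * ofPath k q * z = ofPath k p * (ofPath k q * z) := by
    intro a b p c d q
    refine LinearMap.congr_fun (f := mulBilin (ofPath k p * ofPath k q))
      (g := (mulBilin (ofPath k p)).comp (mulBilin (ofPath k q))) (hom_ext fun e f r => ?_)
    change ofPath k p * ofPath k q * ofPath k r = ofPath k p * (ofPath k q * ofPath k r)
    by_cases h : b = c
    · subst h
      by_cases h' : d = e
      · subst h'
        simp [ofPath_mul_ofPath]
      · rw [ofPath_mul_ofPath, ofPath_mul_ofPath_of_ne _ _ h', ofPath_mul_ofPath_of_ne _ _ h',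
          mul_zero']
    · rw [ofPath_mul_ofPath_of_ne _ _ h, zero_mul']
      by_cases h' : d = e
      · subst h'
        rw [ofPath_mul_ofPath, ofPath_mul_ofPath_of_ne _ _ h]
      · rw [ofPath_mul_ofPath_of_ne _ _ h', mul_zero']
  have h2 : ∀ (a b : V) (p : Quiver.Path a b) (y z : PathAlgebra k V),
      ofPath k p * y * z = ofPath k p * (y * z) := by
    intro a b p y z
    refine LinearMap.congr_fun (f := (mulBilin.flip z).comp (mulBilin (ofPath k p)))
      (g := (mulBilin (ofPath k p)).comp (mulBilin.flip z)) (hom_ext fun c d q => ?_) y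
    exact h1 a b p c d q z
  refine LinearMap.congr_fun (f := (mulBilin.flip z).comp (mulBilin.flip y))
    (g := mulBilin.flip (y * z)) (hom_ext fun a b p => ?_) x
  exact h2 a b p y z

theorem one_mul' [Fintype V] (x : PathAlgebra k V) : 1 * x = x := by
  have key : mulBilin (1 : PathAlgebra k V) = LinearMap.id := by
    refine hom_ext fun a b p => ?_
    change mulBilin (∑ v, vertex k v) (ofPath k p) = ofPath k p
    rw [map_sum, LinearMap.sum_apply, Finset.sum_eq_single a]
    · exact (ofPath_mul_ofPath _ _).trans (by simp)
    · exact fun v _ hv => ofPath_mul_ofPath_of_ne _ _ hv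
    · simp
  exact LinearMap.congr_fun key x

theorem mul_one' [Fintype V] (x : PathAlgebra k V) : x * 1 = x := by
  have key : mulBilin.flip (1 : PathAlgebra k V) = LinearMap.id := by
    refine hom_ext fun a b p => ?_
    change mulBilin (ofPath k p) (∑ v, vertex k v) = ofPath k p
    rw [map_sum, Finset.sum_eq_single b]
    · exact (ofPath_mul_ofPath _ _).trans (by simp)
    · exact fun v _ hv => ofPath_mul_ofPath_of_ne _ _ hv.symm
    · simp
  exact LinearMap.congr_fun key x

instance [Fintype V] : Ring (PathAlgebra k V) where
  __ := (inferInstance : AddCommGroup (PathAlgebra k V))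
  mul_assoc := mul_assoc'
  one_mul := one_mul'
  mul_one := mul_one'
  left_distrib x y z := map_add (mulBilin x) y z
  right_distrib x y z := LinearMap.map_add₂ mulBilin x y z
  zero_mul := zero_mul'
  mul_zero := mul_zero'

instance [Fintype V] : Algebra k (PathAlgebra k V) :=
  Algebra.ofModule (fun c x y => LinearMap.map_smul₂ mulBilin c x y)
    (fun c x y => map_smul (mulBilin x) c y)

end PathAlgebra

/-! ### Bimodules as modules over the enveloping algebra, and their tensor product -/

section Bimodule

/-- The enveloping algebra `A ⊗ Aᵒᵖ`. -/
abbrev Env (k A : Type*) [CommRing k] [Ring A] [Algebra k A] := A ⊗[k] Aᵐᵒᵖ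

variable (k A : Type*) [Field k] [Ring A] [Algebra k A]

/-- `A` is a module over its enveloping algebra by `(a ⊗ b) • x = a x b`. -/
instance envSelf : Module (Env k A) A := TensorProduct.Algebra.module

theorem env_smul_self (a : A) (b : Aᵐᵒᵖ) (x : A) :
    (a ⊗ₜ[k] b : Env k A) • x = a * x * b.unop := by
  rw [mul_assoc]
  exact TensorProduct.Algebra.smul_def a b x

variable {A}

/-- The left action of `A` on a bimodule. -/
def lact {M : Type*} [AddCommGroup M] [Module (Env k A) M] (a : A) (x : M) : M :=
  (a ⊗ₜ[k] (1 : Aᵐᵒᵖ) : Env k A) • x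

/-- The right action of `A` on a bimodule. -/
def ract {M : Type*} [AddCommGroup M] [Module (Env k A) M] (x : M) (a : A) : M :=
  ((1 : A) ⊗ₜ[k] MulOpposite.op a : Env k A) • x

section

variable {k} {M : Type*} [AddCommGroup M] [Module (Env k A) M]

theorem lact_lact (a a' : A) (x : M) : lact k a (lact k a' x) = lact k (a * a') x := by
  simp [lact, smul_smul]

theorem ract_ract (a a' : A) (x : M) : ract k (ract k x a) a' = ract k x (a * a') := by
  simp [ract, smul_smul]

theorem map_lact (η : M →ₗ[Env k A] A) (a : A) (x : M) : η (lact k a x) = a * η x := by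
  simp [lact, env_smul_self]

theorem map_ract (η : M →ₗ[Env k A] A) (a : A) (x : M) : η (ract k x a) = η x * a := by
  simp [ract, env_smul_self]

end

variable (A)

/-- `M ⊗ₖ N`, regarded as a bimodule through the left action on `M` and the right one on `N`. -/
def OuterTensor (M N : Type*) [AddCommGroup M] [Module k M] [AddCommGroup N] [Module k N] :=
  let _ := A
  M ⊗[k] N

section

variable (M N : Type*)
  [AddCommGroup M] [Module k M] [Module (Env k A) M] [IsScalarTower k (Env k A) M]
  [AddCommGroup N] [Module k N] [Module (Env k A) N] [IsScalarTower k (Env k A) N]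

instance : AddCommGroup (OuterTensor k A M N) := inferInstanceAs (AddCommGroup (M ⊗[k] N))
instance : Module k (OuterTensor k A M N) := inferInstanceAs (Module k (M ⊗[k] N))

/-- The outer action: `a ⊗ b` acts as `(a · -) ⊗ (- · b)`. -/
def outerAction : Env k A →ₐ[k] Module.End k (M ⊗[k] N) :=
  (Module.endTensorEndAlgHom (R := k) (S := k) (A := k) (M := M) (N := N)).comp
    (Algebra.TensorProduct.map
      ((Algebra.lsmul k k M).comp
        (Algebra.TensorProduct.includeLeft : A →ₐ[k] Env k A))
      ((Algebra.lsmul k k N).comp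
        (Algebra.TensorProduct.includeRight : Aᵐᵒᵖ →ₐ[k] Env k A)))

instance : Module (Env k A) (OuterTensor k A M N) :=
  Module.compHom (M ⊗[k] N) (outerAction k A M N).toRingHom

/-- The identity map `M ⊗ₖ N → M ⊗ₖ N`, into the type that carries the bimodule structure. -/
def outer : M ⊗[k] N ≃ₗ[k] OuterTensor k A M N := LinearEquiv.refl k (M ⊗[k] N)

variable {M N}

theorem smul_outer (e : Env k A) (z : M ⊗[k] N) :
    e • outer k A M N z = outer k A M N (outerAction k A M N e z) := rfl

theorem outerAction_tmul (a : A) (b : Aᵐᵒᵖ) (x : M) (y : N) :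
    outerAction k A M N (a ⊗ₜ[k] b) (x ⊗ₜ[k] y) = lact k a x ⊗ₜ[k] ract k y b.unop := by
  simp only [outerAction, lact, ract, AlgHom.comp_apply, Algebra.TensorProduct.map_tmul,
    Algebra.TensorProduct.includeLeft_apply, Algebra.TensorProduct.includeRight_apply,
    Module.endTensorEndAlgHom_apply, MulOpposite.op_unop]
  rfl

variable (M N)

/-- The relations `x a ⊗ y - x ⊗ a y`. -/
def balancing : Submodule (Env k A) (OuterTensor k A M N) :=
  Submodule.span (Env k A)
    {z | ∃ (x : M) (a : A) (y : N),
      z = outer k A M N (ract k x a ⊗ₜ[k] y - x ⊗ₜ[k] lact k a y)}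

/-- The tensor product `M ⊗_A N` of two `A`-bimodules, as an `A`-bimodule. -/
abbrev BalTensor := OuterTensor k A M N ⧸ balancing k A M N

variable {M N}

/-- The class of `x ⊗ y` in `M ⊗_A N`. -/
def btmul (x : M) (y : N) : BalTensor k A M N :=
  (balancing k A M N).mkQ (outer k A M N (x ⊗ₜ[k] y))

variable {k A}

theorem lift_outerAction {X : Type*} [AddCommGroup X] [Module k X] [Module (Env k A) X]
    (φ : M →ₗ[k] N →ₗ[k] X)
    (h₁ : ∀ (a : A) (b : Aᵐᵒᵖ) (x : M) (y : N),
      φ (lact k a x) (ract k y b.unop) = (a ⊗ₜ[k] b : Env k A) • φ x y)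
    (e : Env k A) (z : M ⊗[k] N) :
    TensorProduct.lift φ (outerAction k A M N e z) = e • TensorProduct.lift φ z := by
  induction e using TensorProduct.induction_on with
  | zero =>
    rw [map_zero, LinearMap.zero_apply, map_zero]
    exact (zero_smul (Env k A) (TensorProduct.lift φ z)).symm
  | add e e' he he' => rw [map_add, LinearMap.add_apply, map_add, he, he', add_smul]
  | tmul a b =>
    induction z using TensorProduct.induction_on with
    | zero => simp
    | add z z' hz hz' => rw [map_add, map_add, hz, hz', map_add, smul_add]
    | tmul x y =>
      rw [outerAction_tmul, TensorProduct.lift.tmul, TensorProduct.lift.tmul, h₁]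

/-- A `k`-bilinear map of bimodules `M × N → X` that is compatible with the outer actions and
balanced over `A` induces a bimodule map on `M ⊗_A N`. -/
def BalTensor.lift {X : Type*} [AddCommGroup X] [Module k X] [Module (Env k A) X]
    (φ : M →ₗ[k] N →ₗ[k] X)
    (h₁ : ∀ (a : A) (b : Aᵐᵒᵖ) (x : M) (y : N),
      φ (lact k a x) (ract k y b.unop) = (a ⊗ₜ[k] b : Env k A) • φ x y)
    (h₂ : ∀ (x : M) (a : A) (y : N), φ (ract k x a) y = φ x (lact k a y)) :
    BalTensor k A M N →ₗ[Env k A] X :=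
  (balancing k A M N).liftQ
    ({ toFun := fun z => TensorProduct.lift φ ((outer k A M N).symm z)
       map_add' := fun z z' => by rw [map_add, map_add]
       map_smul' := fun e z => by
        obtain ⟨z, rfl⟩ := (outer k A M N).surjective z
        rw [smul_outer, LinearEquiv.symm_apply_apply, LinearEquiv.symm_apply_apply,
          lift_outerAction φ h₁, RingHom.id_apply] } :
      OuterTensor k A M N →ₗ[Env k A] X)
    (Submodule.span_le.2 (by
      rintro _ ⟨x, a, y, rfl⟩
      change TensorProduct.lift φ ((outer k A M N).symm (outer k A M N _)) = 0
      rw [LinearEquiv.symm_apply_apply]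
      refine (map_sub (TensorProduct.lift φ) (ract k x a ⊗ₜ[k] y) (x ⊗ₜ[k] lact k a y)).trans ?_
      rw [TensorProduct.lift.tmul, TensorProduct.lift.tmul, h₂, sub_self]))

theorem BalTensor.lift_btmul {X : Type*} [AddCommGroup X] [Module k X] [Module (Env k A) X]
    (φ : M →ₗ[k] N →ₗ[k] X)
    (h₁ : ∀ (a : A) (b : Aᵐᵒᵖ) (x : M) (y : N),
      φ (lact k a x) (ract k y b.unop) = (a ⊗ₜ[k] b : Env k A) • φ x y)
    (h₂ : ∀ (x : M) (a : A) (y : N), φ (ract k x a) y = φ x (lact k a y)) (x : M) (y : N) :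
    BalTensor.lift φ h₁ h₂ (btmul k A x y) = φ x y := rfl

/-- `(a, x) ↦ a x` as a `k`-bilinear map. -/
def lactBilin : A →ₗ[k] M →ₗ[k] M :=
  LinearMap.mk₂ k (fun a x => lact k a x)
    (fun a a' x => by simp [lact, TensorProduct.add_tmul, add_smul])
    (fun c a x => by
      simp only [lact]
      rw [← TensorProduct.smul_tmul', smul_assoc])
    (fun a x x' => by simp [lact])
    (fun c a x => by
      simp only [lact]
      rw [smul_comm])

/-- `(x, a) ↦ x a` as a `k`-bilinear map. -/
def ractBilin : M →ₗ[k] A →ₗ[k] M :=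
  LinearMap.mk₂ k (fun x a => ract k x a)
    (fun x x' a => by simp [ract])
    (fun c x a => by
      simp only [ract]
      rw [smul_comm])
    (fun x a a' => by simp [ract, TensorProduct.tmul_add, add_smul])
    (fun c x a => by simp [ract, TensorProduct.tmul_smul])

/-- A bimodule map into `A` is `k`-linear. -/
def restrictK (η : M →ₗ[Env k A] A) : M →ₗ[k] A where
  toFun := η
  map_add' := map_add η
  map_smul' c x := by
    have : c • x = lact k (algebraMap k A c) x := by
      rw [lact, ← Algebra.TensorProduct.algebraMap_apply, algebraMap_smul]
    rw [this, map_lact, RingHom.id_apply, Algebra.smul_def]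

/-- `η ⊗ 1 : M ⊗_A N → A ⊗_A N = N`, `x ⊗ y ↦ η(x) y`. -/
def contractLeft (η : M →ₗ[Env k A] A) : BalTensor k A M N →ₗ[Env k A] N :=
  BalTensor.lift (lactBilin.comp (restrictK η))
    (fun a b x y => by
      change lact k (η (lact k a x)) (ract k y b.unop) = _ • lact k (η x) y
      rw [map_lact, ← lact_lact]
      simp only [lact, ract, smul_smul, MulOpposite.op_unop, Algebra.TensorProduct.tmul_mul_tmul,
        one_mul, mul_one])
    (fun x a y => by
      change lact k (η (ract k x a)) y = lact k (η x) (lact k a y)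
      rw [map_ract, lact_lact])

/-- `1 ⊗ η : M ⊗_A N → M ⊗_A A = M`, `x ⊗ y ↦ x η(y)`. -/
def contractRight (η : N →ₗ[Env k A] A) : BalTensor k A M N →ₗ[Env k A] M :=
  BalTensor.lift (ractBilin.compl₂ (restrictK η))
    (fun a b x y => by
      change ract k (lact k a x) (η (ract k y b.unop)) = _ • ract k x (η y)
      rw [map_ract, ← ract_ract]
      simp only [lact, ract, smul_smul, MulOpposite.op_unop, Algebra.TensorProduct.tmul_mul_tmul,
        one_mul, mul_one])
    (fun x a y => by
      change ract k (ract k x a) (η y) = ract k x (η (lact k a y))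
      rw [map_lact, ract_ract])

end

end Bimodule

/-! ### Homotopy liftings -/

section HomotopyLifting

variable (k : Type*) {A : Type*} [Field k] [Ring A] [Algebra k A]
  (P : ℕ → Type*) [∀ n, AddCommGroup (P n)] [∀ n, Module k (P n)]
  [∀ n, Module (Env k A) (P n)] [∀ n, IsScalarTower k (Env k A) (P n)]

variable (A) in
/-- The degree `m` part of `P ⊗_A P`: the direct sum of the `P v ⊗_A P u` with `v + u = m`. -/
def Total (m : ℕ) :=
  ∀ x : {x : ℕ × ℕ // x.1 + x.2 = m}, BalTensor k A (P x.1.1) (P x.1.2)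

instance (m : ℕ) : AddCommGroup (Total k A P m) :=
  inferInstanceAs (AddCommGroup (∀ x : {x : ℕ × ℕ // x.1 + x.2 = m},
    BalTensor k A (P x.1.1) (P x.1.2)))

instance (m : ℕ) : Module (Env k A) (Total k A P m) :=
  inferInstanceAs (Module (Env k A) (∀ x : {x : ℕ × ℕ // x.1 + x.2 = m},
    BalTensor k A (P x.1.1) (P x.1.2)))

variable {k P}

/-- The element of `P ⊗_A P` with given components in the `P v ⊗_A P u`. -/
def Total.of {m : ℕ} (z : ∀ v u : ℕ, v + u = m → BalTensor k A (P v) (P u)) : Total k A P m :=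
  fun x => z x.1.1 x.1.2 x.2

/-- The component of an element of `P ⊗_A P` in `P v ⊗_A P u`. -/
def Total.component {m : ℕ} (v u : ℕ) (h : v + u = m) :
    Total k A P m →ₗ[Env k A] BalTensor k A (P v) (P u) :=
  LinearMap.proj (φ := fun x : {x : ℕ × ℕ // x.1 + x.2 = m} =>
    BalTensor k A (P x.1.1) (P x.1.2)) ⟨(v, u), h⟩

/-- `η ⊗ 1` on `P ⊗_A P`, for `η` of degree `n`: it is `x ⊗ y ↦ η(x) y` on the summand
`P n ⊗_A P l` and vanishes on the other summands of degree `m = n + l`. -/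
def tensorOne {n : ℕ} (η : P n →ₗ[Env k A] A) {m l : ℕ} (h : n + l = m) :
    Total k A P m →ₗ[Env k A] P l :=
  (contractLeft η).comp (Total.component n l h)

/-- `1 ⊗ η` on `P ⊗_A P`, for `η` of degree `n`, with the Koszul sign: it is
`x ⊗ y ↦ (-1) ^ (n l) x η(y)` on the summand `P l ⊗_A P n`, and vanishes on the others. -/
def oneTensor {n : ℕ} (η : P n →ₗ[Env k A] A) {m l : ℕ} (h : l + n = m) :
    Total k A P m →ₗ[Env k A] P l :=
  (-1 : ℤ) ^ (n * l) •
    (contractRight η).comp (Total.component l n h)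

/-- `(η ⊗ 1 - 1 ⊗ η) Δ` in degree `m = l + n`. -/
def commutatorWith (Δ : ∀ m, P m →ₗ[Env k A] Total k A P m) {n : ℕ} (η : P n →ₗ[Env k A] A)
    (l : ℕ) : P (l + n) →ₗ[Env k A] P l :=
  (tensorOne η (Nat.add_comm n l) - oneTensor η rfl).comp (Δ (l + n))

/-- `ψ` is a homotopy lifting of the `n`-cocycle `η`, with respect to the diagonal map `Δ`, for a
complex `P` with augmentation `μ`.

Homogeneous maps are given by all their components `P i → P j`. For `d` the components with
`i = j + 1` matter (the others are `0`), for `ψ : P → P[1 - n]` those with `i + 1 = j + n`, for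
`φ : P → P[1]` those with `i + 1 = j`.

The first condition is `d ψ - (-1) ^ (n - 1) ψ d = (η ⊗ 1 - 1 ⊗ η) Δ`, in degree `l + n`
(in degrees `< n` its two sides are maps to `0`). The second one is that
`μ ψ - (-1) ^ (n - 1) η φ` is a coboundary, for some `φ` with
`d φ + φ d = (μ ⊗ 1 - 1 ⊗ μ) Δ`. -/
structure IsHomotopyLifting (d : ∀ i j, P i →ₗ[Env k A] P j) (μ : P 0 →ₗ[Env k A] A)
    (Δ : ∀ m, P m →ₗ[Env k A] Total k A P m) {n : ℕ} (η : P n →ₗ[Env k A] A)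
    (ψ : ∀ i j, P i →ₗ[Env k A] P j) : Prop where
  boundary : ∀ l : ℕ,
    (d (l + 1) l).comp (ψ (l + n) (l + 1))
      - (-1 : ℤ) ^ (n + 1) • (ψ (l + n - 1) l).comp (d (l + n) (l + n - 1))
    = commutatorWith Δ η l
  augmentation : ∃ φ : ∀ i j, P i →ₗ[Env k A] P j,
    (∀ m : ℕ, (d (m + 1) m).comp (φ m (m + 1)) + (φ (m - 1) m).comp (d m (m - 1))
      = commutatorWith Δ μ m) ∧
    ∀ m : ℕ, m + 1 = n → ∃ χ : P (m - 1) →ₗ[Env k A] A,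
      μ.comp (ψ m 0) - (-1 : ℤ) ^ (n + 1) • η.comp (φ m n) = χ.comp (d m (m - 1))

end HomotopyLifting

/-! ### Koszul quiver algebras and their bimodule resolution -/

section Koszul

variable {k V : Type*} [Field k] [Fintype V] [Quiver V]

/-- The linear combinations of paths of length `n` from `a` to `b`. -/
def uniformPart (k : Type*) {V : Type*} [Field k] [Quiver V] (n : ℕ) (a b : V) :
    Submodule k (PathAlgebra k V) :=
  Submodule.span k {x | ∃ p : Quiver.Path a b, p.length = n ∧ x = PathAlgebra.ofPath k p}

/-- The quiver algebra `Λ = kQ/I`. -/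
def QuiverAlgebra (I : Ideal (PathAlgebra k V)) [I.IsTwoSided] := PathAlgebra k V ⧸ I

section

variable (I : Ideal (PathAlgebra k V)) [I.IsTwoSided]

instance : Ring (QuiverAlgebra I) := inferInstanceAs (Ring (PathAlgebra k V ⧸ I))
instance : Algebra k (QuiverAlgebra I) := inferInstanceAs (Algebra k (PathAlgebra k V ⧸ I))

/-- The projection `kQ → kQ/I`. -/
def QuiverAlgebra.mk : PathAlgebra k V →ₐ[k] QuiverAlgebra I := Ideal.Quotient.mkₐ k I

end

/-- Let `R = kQ`, `I` an ideal of `R` and `Λ = R/I`, graded by length of paths. This structure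
consists of uniform elements `f n i` of `R`, with `i < num n`, homogeneous of degree `n`, that
define a (minimal) linear projective resolution of `Λ₀` as a right `Λ`-module, with terms
`⨁ᵢ f n i R / ⨁ᵢ f n i I` and differentials induced by the inclusions
`⨁ᵢ f (n + 1) i R ⊆ ⨁ᵢ f n i R`. The algebra `Λ` is Koszul if there is such a resolution. -/
structure LinearResolution (I : Ideal (PathAlgebra k V)) [I.IsTwoSided] where
  /-- the number of the `f n i` -/
  num : ℕ → ℕ
  f : ∀ n, Fin (num n) → PathAlgebra k V
  /-- the origin of `f n i` -/
  org : ∀ n, Fin (num n) → V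
  /-- the terminus of `f n i` -/
  ter : ∀ n, Fin (num n) → V
  uniform : ∀ n i, f n i ∈ uniformPart k n (org n i) (ter n i)
  /-- the `f 0 i` are the vertices -/
  vert : Fin (num 0) ≃ V
  f_zero : ∀ i, f 0 i = PathAlgebra.vertex k (vert i)
  /-- the `f 1 i` are the arrows -/
  arrow : Fin (num 1) ≃ Σ a : V, Σ b : V, (a ⟶ b)
  f_one : ∀ i, f 1 i = PathAlgebra.ofPath k (arrow i).2.2.toPath
  /-- the `f 2 i` generate the ideal of relations -/
  f_two : I = TwoSidedIdeal.asIdeal (TwoSidedIdeal.span (Set.range (f 2)))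
  /-- the sum of the right ideals `f n i R` is direct, and `f n i R` is isomorphic to
  `e R` for the terminus `e` of `f n i` -/
  free : ∀ n (x : Fin (num n) → PathAlgebra k V), ∑ i, f n i * x i = 0 →
    ∀ i, PathAlgebra.vertex k (ter n i) * x i = 0
  /-- exactness: the kernel of `⨁ f (n + 1) i R / ⨁ f (n + 1) i I → ⨁ f n i R / ⨁ f n i I` is the
  image of `⨁ f (n + 2) i R` (products are products of `k`-subspaces of `R`) -/
  exact : ∀ n,
    Submodule.span k (Set.range (f (n + 1))) * ⊤ ⊓
      Submodule.span k (Set.range (f n)) * I.restrictScalars k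
    = Submodule.span k (Set.range (f (n + 2))) * ⊤ ⊔
      Submodule.span k (Set.range (f (n + 1))) * I.restrictScalars k

namespace LinearResolution

variable {I : Ideal (PathAlgebra k V)} [I.IsTwoSided] (S : LinearResolution I)

/-- The comultiplicative equation
`f n i = ∑ c n i v p q • (f v p * f u q)`, where `n = v + u` and `c n i v p q` is the scalar
usually written `c_{pq}(n, i, v)`. (Values of `c` at other indices are irrelevant.) -/
def IsComultiplication (c : ℕ → ℕ → ℕ → ℕ → ℕ → k) : Prop :=
  ∀ (v u : ℕ) (i : Fin (S.num (v + u))),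
    S.f (v + u) i = ∑ p : Fin (S.num v), ∑ q : Fin (S.num u),
      c (v + u) i v p q • (S.f v p * S.f u q)

/-- The residue class in `Λ` of a vertex. -/
def idem (_ : LinearResolution I) (v : V) : QuiverAlgebra I :=
  QuiverAlgebra.mk I (PathAlgebra.vertex k v)

/-- The residue class in `Λ` of the arrow `f 1 p`. -/
def arr (p : Fin (S.num 1)) : QuiverAlgebra I := QuiverAlgebra.mk I (S.f 1 p)

/-- `o(f n i) ⊗ t(f n i)` in the enveloping algebra of `Λ`. -/
def gen (n : ℕ) (i : Fin (S.num n)) : Env k (QuiverAlgebra I) :=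
  S.idem (S.org n i) ⊗ₜ[k] MulOpposite.op (S.idem (S.ter n i))

/-- The bimodule `⨁ᵢ Λ o(f n i) ⊗ t(f n i) Λ`. Its `i`-th summand is the left ideal of
`Λ ⊗ Λᵒᵖ` generated by `o(f n i) ⊗ t(f n i)`. -/
def K (n : ℕ) := ∀ i : Fin (S.num n),
  (Ideal.span {S.gen n i} : Ideal (Env k (QuiverAlgebra I)))

instance (n : ℕ) : AddCommGroup (S.K n) :=
  inferInstanceAs (AddCommGroup (∀ i : Fin (S.num n),
    (Ideal.span {S.gen n i} : Ideal (Env k (QuiverAlgebra I)))))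

instance (n : ℕ) : Module (Env k (QuiverAlgebra I)) (S.K n) :=
  inferInstanceAs (Module (Env k (QuiverAlgebra I)) (∀ i : Fin (S.num n),
    (Ideal.span {S.gen n i} : Ideal (Env k (QuiverAlgebra I)))))

instance (n : ℕ) : Module k (S.K n) :=
  inferInstanceAs (Module k (∀ i : Fin (S.num n),
    (Ideal.span {S.gen n i} : Ideal (Env k (QuiverAlgebra I)))))

instance (n : ℕ) : IsScalarTower k (Env k (QuiverAlgebra I)) (S.K n) :=
  inferInstanceAs (IsScalarTower k (Env k (QuiverAlgebra I)) (∀ i : Fin (S.num n),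
    (Ideal.span {S.gen n i} : Ideal (Env k (QuiverAlgebra I)))))

/-- The `i`-th coordinate of an element of `K n`, in `Λ ⊗ Λᵒᵖ`. -/
def coord (n : ℕ) (i : Fin (S.num n)) :
    S.K n →ₗ[Env k (QuiverAlgebra I)] Env k (QuiverAlgebra I) :=
  (Submodule.subtype (Ideal.span {S.gen n i})).comp
    (LinearMap.proj (φ := fun i : Fin (S.num n) =>
      (Ideal.span {S.gen n i} : Ideal (Env k (QuiverAlgebra I)))) i)

/-- The generator `ε n i` of the `i`-th summand of `K n` (and `0` if `i` is not an index). -/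
def ε (n i : ℕ) : S.K n := fun j =>
  if (j : ℕ) = i then ⟨S.gen n j, Ideal.mem_span_singleton_self _⟩ else 0

/-- The bimodule map on `K n` with `ε n i ↦ (o(f n i) ⊗ t(f n i)) • x i`, which is `x i` if
`x i` lies in `o(f n i) X t(f n i)`. -/
def extend {n : ℕ} {X : Type*} [AddCommGroup X] [Module (Env k (QuiverAlgebra I)) X]
    (x : Fin (S.num n) → X) : S.K n →ₗ[Env k (QuiverAlgebra I)] X :=
  ∑ i, (LinearMap.toSpanSingleton (Env k (QuiverAlgebra I)) X (x i)).comp (S.coord n i)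

/-- The differential `K n → K (n - 1)`,
`ε n r ↦ ∑ⱼ (∑ₚ c_{pj}(n, r, 1) f¹ₚ ε^{n-1}ⱼ + (-1)ⁿ ∑_q c_{jq}(n, r, n - 1) ε^{n-1}ⱼ f¹_q)`,
and `0` as a map between other degrees. -/
def d (c : ℕ → ℕ → ℕ → ℕ → ℕ → k) (n m : ℕ) :
    S.K n →ₗ[Env k (QuiverAlgebra I)] S.K m :=
  if n = m + 1 then
    S.extend fun r => ∑ j : Fin (S.num m),
      (∑ p : Fin (S.num 1), c n r 1 p j • lact k (S.arr p) (S.ε m j)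
        + (-1 : k) ^ n • ∑ q : Fin (S.num 1), c n r m j q • ract k (S.ε m j) (S.arr q))
  else 0

/-- The augmentation `K 0 → Λ`, given by multiplication. -/
def μ : S.K 0 →ₗ[Env k (QuiverAlgebra I)] (QuiverAlgebra I) :=
  S.extend fun _ => 1

/-- The diagonal map `Δ(ε m r) = ∑ ∑ₚ ∑_q c_{pq}(m, r, v) ε v p ⊗ ε u q`, where the outer sum is
over the `v`, `u` with `v + u = m`. -/
def Δ (c : ℕ → ℕ → ℕ → ℕ → ℕ → k) (m : ℕ) :
    S.K m →ₗ[Env k (QuiverAlgebra I)] Total k (QuiverAlgebra I) S.K m :=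
  S.extend fun r => Total.of fun v u _ => ∑ p : Fin (S.num v), ∑ q : Fin (S.num u),
    btmul k (QuiverAlgebra I) (c m r v p q • S.ε v p) (S.ε u q)

end LinearResolution

end Koszul

end KoszulLift

end

/-! A bimodule map out of `S.K m` is determined by its values on the generators (`hom_ext`), so the
boundary equation in degree m = l + n is checked at each ε^m_r. There each of its three terms takes
the form `gen m r • ∑ α, sideSum …`, a combination of the elements f¹_p ε^l_α and ε^l_α f¹_q with
explicit scalars. `smul_d_ε` gives dψ. `monomial_d_ε` gives ψd, where condition (C) replaces the
scalars of the differential of ε^m_r by those indexed by m - n + 1, so that the terms can be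
regrouped by α. `commutatorWith_ε_of_single` gives the right-hand side, where only p = w and q = w
survive. Equality of the scalars on the left products is condition (i), and on the right products
condition (ii).

For the augmentation condition φ = 0 suffices: `commutatorWith_μ` says that (μ ⊗ 1 - 1 ⊗ μ)Δ = 0.
This follows from the comultiplicative equation at v = 0 and v = m, since the f^m_q are linearly
independent. Then only μψ remains, and it vanishes because ψ is zero on K_{n-1}. -/

namespace KoszulLift

/-! ### Scalars and two-sided sums in bimodules. -/

section Bimodule

variable {k A : Type*} [Field k] [Ring A] [Algebra k A]
  {M N : Type*} [AddCommGroup M] [Module (Env k A) M] [AddCommGroup N] [Module (Env k A) N]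

theorem map_lact' (F : M →ₗ[Env k A] N) (a : A) (x : M) : F (lact k a x) = lact k a (F x) :=
  map_smul F _ x

theorem map_ract' (F : M →ₗ[Env k A] N) (x : M) (a : A) : F (ract k x a) = ract k (F x) a :=
  map_smul F _ x

variable [Module k M] [Module k N]

variable (k) in
/-- The element `∑ₚ xₚ aₚ z + ∑ₚ yₚ z aₚ` of a bimodule. -/
noncomputable def sideSum {ι : Type*} [Fintype ι] (a : ι → A) (x y : ι → k) (z : M) : M :=
  ∑ p, x p • lact k (a p) z + ∑ q, y q • ract k z (a q)

variable {ι : Type*} [Fintype ι] (a : ι → A)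

theorem smul_sideSum (c : k) (x y : ι → k) (z : M) :
    c • sideSum k a x y z = sideSum k a (fun p => c * x p) (fun q => c * y q) z := by
  simp only [sideSum, smul_add, Finset.smul_sum, smul_smul]

theorem sideSum_add (x y x' y' : ι → k) (z : M) :
    sideSum k a x y z + sideSum k a x' y' z
      = sideSum k a (fun p => x p + x' p) (fun q => y q + y' q) z := by
  simp only [sideSum, add_smul, Finset.sum_add_distrib]
  abel

theorem sideSum_single [DecidableEq ι] (w : ι) (x y : k) (z : M) :
    sideSum k a (fun p => if p = w then x else 0) (fun q => if q = w then y else 0) z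
      = x • lact k (a w) z + y • ract k z (a w) := by
  simp [sideSum, ite_smul]

variable [IsScalarTower k (Env k A) M] [IsScalarTower k (Env k A) N]

theorem lact_smul (c : k) (a : A) (x : M) : lact k a (c • x) = c • lact k a x :=
  map_smul (lactBilin (k := k) a) c x

theorem ract_smul (c : k) (a : A) (x : M) : ract k (c • x) a = c • ract k x a :=
  LinearMap.map_smul₂ (ractBilin (k := k)) c x a

theorem zero_lact (x : M) : lact k (0 : A) x = 0 :=
  LinearMap.map_zero₂ (lactBilin (k := k)) x

theorem ract_zero (x : M) : ract k x (0 : A) = 0 :=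
  map_zero (ractBilin (k := k) x)

theorem smul_lact (c : k) (a : A) (x : M) : lact k (c • a) x = c • lact k a x :=
  LinearMap.map_smul₂ (lactBilin (k := k)) c a x

theorem contractLeft_btmul (η : M →ₗ[Env k A] A) (c : k) (x : M) (y : N) :
    contractLeft η (btmul k A (c • x) y) = c • lact k (η x) y := by
  change lact k (restrictK η (c • x)) y = _
  rw [map_smul, smul_lact]
  rfl

theorem contractRight_btmul (η : N →ₗ[Env k A] A) (c : k) (x : M) (y : N) :
    contractRight η (btmul k A (c • x) y) = c • ract k x (η y) :=
  ract_smul c (η y) x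

theorem map_sideSum (F : M →ₗ[Env k A] N) (x y : ι → k) (z : M) :
    F (sideSum k a x y z) = sideSum k a x y (F z) := by
  simp only [sideSum, map_add, map_sum, LinearMap.map_smul_of_tower, map_lact', map_ract']

theorem sideSum_smul (c : k) (x y : ι → k) (z : M) :
    sideSum k a x y (c • z) = c • sideSum k a x y z := by
  simp only [sideSum, lact_smul, ract_smul, smul_add, Finset.smul_sum, smul_comm c]

end Bimodule

/-! ### Vertex idempotents acting on uniform elements. -/

namespace PathAlgebra

variable {k V : Type*} [Field k] [Quiver V]

theorem vertex_ne_zero (v : V) : vertex k v ≠ 0 :=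
  Finsupp.single_ne_zero.2 one_ne_zero

theorem vertex_mul_vertex_self (v : V) : vertex k v * vertex k v = vertex k v :=
  ofPath_mul_ofPath _ _

theorem vertex_mul_vertex_of_ne {v v' : V} (h : v ≠ v') : vertex k v * vertex k v' = 0 :=
  ofPath_mul_ofPath_of_ne _ _ h

variable [Fintype V]

theorem vertex_mul_of_mem {n : ℕ} {a b : V} {x : PathAlgebra k V} (hx : x ∈ uniformPart k n a b) :
    vertex k a * x = x := by
  induction hx using Submodule.span_induction with
  | mem x h =>
    obtain ⟨p, -, rfl⟩ := h
    exact (ofPath_mul_ofPath _ _).trans (by simp)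
  | zero => exact mul_zero _
  | add x y _ _ hx hy => rw [mul_add, hx, hy]
  | smul c x _ hx => rw [mul_smul_comm, hx]

theorem mul_vertex_of_mem {n : ℕ} {a b : V} {x : PathAlgebra k V} (hx : x ∈ uniformPart k n a b) :
    x * vertex k b = x := by
  induction hx using Submodule.span_induction with
  | mem x h =>
    obtain ⟨p, -, rfl⟩ := h
    exact (ofPath_mul_ofPath _ _).trans (by simp)
  | zero => exact zero_mul _
  | add x y _ _ hx hy => rw [add_mul, hx, hy]
  | smul c x _ hx => rw [smul_mul_assoc, hx]

end PathAlgebra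

/-! ### The generators of the bimodules K_n. -/

namespace LinearResolution

open PathAlgebra

variable {k V : Type*} [Field k] [Fintype V] [Quiver V]
  {I : Ideal (PathAlgebra k V)} [I.IsTwoSided] (S : LinearResolution I)

theorem idem_mul_self (v : V) : S.idem v * S.idem v = S.idem v := by
  rw [idem, ← map_mul, vertex_mul_vertex_self]

theorem idem_mul_of_ne {v v' : V} (h : v ≠ v') : S.idem v * S.idem v' = 0 := by
  rw [idem, idem, ← map_mul, vertex_mul_vertex_of_ne h, map_zero]

/-- Distinct vertex idempotents are orthogonal, so a nonzero vertex can be uniform only with itself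
as origin. -/
theorem org_zero (p : Fin (S.num 0)) : S.org 0 p = S.vert p := by
  by_contra h
  have := vertex_mul_of_mem (S.uniform 0 p)
  rw [S.f_zero, vertex_mul_vertex_of_ne h] at this
  exact vertex_ne_zero _ this.symm

theorem ter_zero (p : Fin (S.num 0)) : S.ter 0 p = S.vert p := by
  by_contra h
  have := mul_vertex_of_mem (S.uniform 0 p)
  rw [S.f_zero, vertex_mul_vertex_of_ne (Ne.symm h)] at this
  exact vertex_ne_zero _ this.symm

theorem gen_smul_gen (n : ℕ) (r : Fin (S.num n)) : S.gen n r • S.gen n r = S.gen n r := by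
  simp only [gen, smul_eq_mul, Algebra.TensorProduct.tmul_mul_tmul, ← MulOpposite.op_mul,
    idem_mul_self]

theorem coord_ε (n : ℕ) (j r : Fin (S.num n)) :
    S.coord n j (S.ε n r) = if j = r then S.gen n r else 0 := by
  change ((S.ε n r j : (Ideal.span {S.gen n j} : Ideal (Env k (QuiverAlgebra I)))) :
    Env k (QuiverAlgebra I)) = _
  by_cases h : j = r
  · subst h; simp [ε]
  · have h' : ¬ (j : ℕ) = r := fun e => h (Fin.ext e)
    simp [ε, h, h']

theorem coord_injective {n : ℕ} {x y : S.K n} (h : ∀ j, S.coord n j x = S.coord n j y) :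
    x = y :=
  funext fun j => Subtype.ext (h j)

/-- The only nonzero coordinate of ε^n_r is the r-th, so its relations over the enveloping algebra
can be read off from `gen n r`. -/
theorem smul_ε {n : ℕ} (e e' : Env k (QuiverAlgebra I)) (r : Fin (S.num n))
    (h : e • S.gen n r = e' • S.gen n r) : e • S.ε n r = e' • S.ε n r := by
  refine S.coord_injective fun j => ?_
  rw [map_smul, map_smul, coord_ε]
  split_ifs
  · exact h
  · simp

theorem gen_smul_ε {n : ℕ} (r : Fin (S.num n)) : S.gen n r • S.ε n r = S.ε n r := by
  have := S.smul_ε (S.gen n r) 1 r (by rw [gen_smul_gen, one_smul])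
  rwa [one_smul] at this

/-- Orthogonality of the idempotents; this is what selects the terms with matching origin in the
counit computation. -/
theorem lact_idem_ε {n : ℕ} (v : V) (r : Fin (S.num n)) [Decidable (S.org n r = v)] :
    lact k (S.idem v) (S.ε n r) = if S.org n r = v then S.ε n r else 0 := by
  split_ifs with h
  · subst h
    have := S.smul_ε (S.idem (S.org n r) ⊗ₜ[k] 1) 1 r (by
      simp only [gen, smul_eq_mul, Algebra.TensorProduct.tmul_mul_tmul, idem_mul_self, one_mul])
    rwa [one_smul] at this
  · have := S.smul_ε (S.idem v ⊗ₜ[k] 1) 0 r (by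
      simp only [gen, smul_eq_mul, Algebra.TensorProduct.tmul_mul_tmul,
        S.idem_mul_of_ne (Ne.symm h), TensorProduct.zero_tmul, zero_mul])
    exact this.trans (zero_smul (Env k (QuiverAlgebra I)) (S.ε n r))

theorem ract_ε_idem {n : ℕ} (v : V) (r : Fin (S.num n)) [Decidable (S.ter n r = v)] :
    ract k (S.ε n r) (S.idem v) = if S.ter n r = v then S.ε n r else 0 := by
  split_ifs with h
  · subst h
    have := S.smul_ε (1 ⊗ₜ[k] MulOpposite.op (S.idem (S.ter n r))) 1 r (by
      simp only [gen, smul_eq_mul, Algebra.TensorProduct.tmul_mul_tmul, ← MulOpposite.op_mul,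
        idem_mul_self, one_mul])
    rwa [one_smul] at this
  · have := S.smul_ε (1 ⊗ₜ[k] MulOpposite.op (S.idem v)) 0 r (by
      simp only [gen, smul_eq_mul, Algebra.TensorProduct.tmul_mul_tmul, ← MulOpposite.op_mul,
        S.idem_mul_of_ne h, MulOpposite.op_zero, TensorProduct.tmul_zero, zero_mul])
    exact this.trans (zero_smul (Env k (QuiverAlgebra I)) (S.ε n r))

/-- The idempotent `gen n r` stays because `x r` need not have the right origin and terminus. When
two values are compared it is a common factor, so incompatible terms never have to be removed by
hand. -/
theorem extend_ε {n : ℕ} {X : Type*} [AddCommGroup X] [Module (Env k (QuiverAlgebra I)) X]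
    (x : Fin (S.num n) → X) (r : Fin (S.num n)) :
    S.extend x (S.ε n r) = S.gen n r • x r := by
  rw [extend, LinearMap.sum_apply, Finset.sum_eq_single r]
  · simp [coord_ε]
  · intro j _ hj
    rw [LinearMap.comp_apply, coord_ε, if_neg hj, map_zero]
  · simp

/-- The summands are cyclic left ideals: every coordinate of z is a multiple of `gen n j`, and the
multipliers write z as a combination of the generators. -/
theorem hom_ext {n : ℕ} {X : Type*} [AddCommGroup X] [Module (Env k (QuiverAlgebra I)) X]
    {F G : S.K n →ₗ[Env k (QuiverAlgebra I)] X}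
    (h : ∀ r : Fin (S.num n), F (S.ε n r) = G (S.ε n r)) :
    F = G := by
  refine LinearMap.ext fun z => ?_
  have hz : ∀ j, ∃ e : Env k (QuiverAlgebra I), e • S.gen n j = S.coord n j z := fun j =>
    Ideal.mem_span_singleton'.1 (z j).2
  choose e he using hz
  have : z = ∑ j, e j • S.ε n j := by
    refine S.coord_injective fun j => ?_
    rw [map_sum, Finset.sum_eq_single j]
    · rw [map_smul, coord_ε, if_pos rfl, he]
    · intro i _ hi
      rw [map_smul, coord_ε, if_neg (Ne.symm hi), smul_zero]
    · simp
  rw [this, map_sum, map_sum]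
  simp only [map_smul, h]

theorem μ_ε (p : Fin (S.num 0)) : S.μ (S.ε 0 p) = S.idem (S.vert p) := by
  rw [μ, extend_ε, gen, env_smul_self, org_zero, ter_zero, mul_one, MulOpposite.unop_op,
    idem_mul_self]

theorem d_of_ne (c : ℕ → ℕ → ℕ → ℕ → ℕ → k) {n m : ℕ} (h : n ≠ m + 1) : S.d c n m = 0 :=
  if_neg h

theorem d_ε (c : ℕ → ℕ → ℕ → ℕ → ℕ → k) {n m : ℕ} (h : n = m + 1) (r : Fin (S.num n)) :
    S.d c n m (S.ε n r) = S.gen n r • ∑ j : Fin (S.num m),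
      sideSum k S.arr (fun p => c n r 1 p j) (fun q => (-1) ^ n * c n r m j q) (S.ε m j) := by
  rw [d, if_pos h, extend_ε]
  simp only [sideSum, Finset.smul_sum, mul_smul]

theorem commutatorWith_ε (c : ℕ → ℕ → ℕ → ℕ → ℕ → k) {n : ℕ}
    (η : S.K n →ₗ[Env k (QuiverAlgebra I)] QuiverAlgebra I) (l : ℕ) (r : Fin (S.num (l + n))) :
    commutatorWith (S.Δ c) η l (S.ε (l + n) r) = S.gen (l + n) r •
      ((∑ p : Fin (S.num n), ∑ q : Fin (S.num l),
          c (l + n) r n p q • lact k (η (S.ε n p)) (S.ε l q))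
        - (-1 : ℤ) ^ (n * l) • ∑ p : Fin (S.num l), ∑ q : Fin (S.num n),
          c (l + n) r l p q • ract k (S.ε l p) (η (S.ε n q))) := by
  simp only [← contractLeft_btmul, ← contractRight_btmul, ← map_sum]
  rw [commutatorWith, LinearMap.comp_apply, Δ, extend_ε, map_smul]
  rfl

/-! ### Counitality of the diagonal map. -/

/-- Directness of the sum of the f^n_i R, applied to scalar coefficients: a nonzero scalar multiple
of a vertex is nonzero. -/
theorem linearIndependent_f (n : ℕ) {x y : Fin (S.num n) → k}
    (h : ∑ i, x i • S.f n i = ∑ i, y i • S.f n i) : x = y := by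
  funext i
  have := S.free n (fun i => (x i - y i) • 1) (by
    simp only [mul_smul_comm, mul_one]
    simp only [sub_smul, Finset.sum_sub_distrib, h, sub_self]) i
  rw [mul_smul_comm, mul_one, smul_eq_zero] at this
  exact sub_eq_zero.1 (this.resolve_right (vertex_ne_zero _))

variable {S} in
theorem IsComultiplication.eq {c : ℕ → ℕ → ℕ → ℕ → ℕ → k} (hc : S.IsComultiplication c)
    {m v u : ℕ} (h : v + u = m) (i : Fin (S.num m)) :
    S.f m i = ∑ p : Fin (S.num v), ∑ q : Fin (S.num u), c m i v p q • (S.f v p * S.f u q) := by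
  subst h
  exact hc v u i

open Classical in
variable {S} in
/-- The counit identity `∑ₚ c_{pq}(m, r, 0) = δ_{qr}`, the sum being over the `p` for which `f 0 p`
is the origin of `f m q`. -/
theorem IsComultiplication.counit_left {c : ℕ → ℕ → ℕ → ℕ → ℕ → k} (hc : S.IsComultiplication c)
    (m : ℕ) (r q : Fin (S.num m)) :
    (∑ p : Fin (S.num 0), if S.org m q = S.vert p then c m r 0 p q else 0)
      = if q = r then 1 else 0 := by
  refine congrFun (S.linearIndependent_f m (x := fun q => ∑ p : Fin (S.num 0),
    if S.org m q = S.vert p then c m r 0 p q else 0) (y := fun q => if q = r then 1 else 0) ?_) q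
  simp only [ite_smul, one_smul, zero_smul, Finset.sum_ite_eq', Finset.mem_univ, if_true]
  -- Expanding f^m_r at v = 0 turns the claim into a comparison of coefficients of the f^m_q.
  rw [hc.eq (Nat.zero_add m) r, Finset.sum_comm]
  simp only [Finset.sum_smul]
  refine Finset.sum_congr rfl fun q _ => Finset.sum_congr rfl fun p _ => ?_
  rw [S.f_zero, ite_smul, zero_smul]
  split_ifs with h
  · rw [← h, vertex_mul_of_mem (S.uniform m q)]
  -- When f^0_p is not the origin of f^m_q the product is zero, so the equation does not constrain
  -- that scalar; hence the restricted sum.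
  · rw [← vertex_mul_of_mem (S.uniform m q), ← mul_assoc, vertex_mul_vertex_of_ne (Ne.symm h),
      zero_mul, smul_zero]

open Classical in
variable {S} in
/-- The counit identity `∑_q c_{pq}(m, r, m) = δ_{pr}`, the sum being over the `q` for which `f 0 q`
is the terminus of `f m p`. -/
theorem IsComultiplication.counit_right {c : ℕ → ℕ → ℕ → ℕ → ℕ → k}
    (hc : S.IsComultiplication c) (m : ℕ) (r p : Fin (S.num m)) :
    (∑ q : Fin (S.num 0), if S.ter m p = S.vert q then c m r m p q else 0)
      = if p = r then 1 else 0 := by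
  refine congrFun (S.linearIndependent_f m (x := fun p => ∑ q : Fin (S.num 0),
    if S.ter m p = S.vert q then c m r m p q else 0) (y := fun p => if p = r then 1 else 0) ?_) p
  simp only [ite_smul, one_smul, zero_smul, Finset.sum_ite_eq', Finset.mem_univ, if_true]
  rw [hc.eq (Nat.add_zero m) r]
  simp only [Finset.sum_smul]
  refine Finset.sum_congr rfl fun p _ => Finset.sum_congr rfl fun q _ => ?_
  rw [S.f_zero, ite_smul, zero_smul]
  split_ifs with h
  · rw [← h, mul_vertex_of_mem (S.uniform m p)]
  · rw [← mul_vertex_of_mem (S.uniform m p), mul_assoc, vertex_mul_vertex_of_ne h,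
      mul_zero, smul_zero]

variable {S} in
/-- The diagonal map is strictly counital: `(μ ⊗ 1) Δ = 1 = (1 ⊗ μ) Δ`. -/
theorem commutatorWith_μ {c : ℕ → ℕ → ℕ → ℕ → ℕ → k} (hc : S.IsComultiplication c) (m : ℕ) :
    commutatorWith (S.Δ c) S.μ m = 0 := by
  classical
  refine S.hom_ext fun r => ?_
  rw [commutatorWith_ε, LinearMap.zero_apply]
  have h₁ : (∑ p : Fin (S.num 0), ∑ q : Fin (S.num m),
      c m r 0 p q • lact k (S.μ (S.ε 0 p)) (S.ε m q)) = S.ε m r := by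
    rw [Finset.sum_comm]
    calc _ = ∑ q : Fin (S.num m), (∑ p : Fin (S.num 0),
          if S.org m q = S.vert p then c m r 0 p q else 0) • S.ε m q := by
          simp only [Finset.sum_smul, μ_ε, lact_idem_ε, smul_ite, ite_smul, smul_zero, zero_smul]
      _ = _ := by
        simp only [hc.counit_left m r, ite_smul, one_smul, zero_smul, Finset.sum_ite_eq',
          Finset.mem_univ, if_true]
  have h₂ : (∑ p : Fin (S.num m), ∑ q : Fin (S.num 0),
      c m r m p q • ract k (S.ε m p) (S.μ (S.ε 0 q))) = S.ε m r := by
    calc _ = ∑ p : Fin (S.num m), (∑ q : Fin (S.num 0),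
          if S.ter m p = S.vert q then c m r m p q else 0) • S.ε m p := by
          simp only [Finset.sum_smul, μ_ε, ract_ε_idem, smul_ite, ite_smul, smul_zero, zero_smul]
      _ = _ := by
        simp only [hc.counit_right m r, ite_smul, one_smul, zero_smul, Finset.sum_ite_eq',
          Finset.mem_univ, if_true]
  have h₃ : (-1 : ℤ) ^ (0 * m) = 1 := by simp
  rw [h₃, one_smul]
  exact (congrArg (S.gen m r • ·) (sub_eq_zero.2 (h₁.trans h₂.symm))).trans (smul_zero _)

/-! ### The three terms of the boundary equation on generators. -/

/-- The bimodule map `K m → K l` with `ε m r ↦ x r ε l (t r)`, if this is compatible with origins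
and termini. -/
noncomputable def monomialMap (m l : ℕ) (x : Fin (S.num m) → k) (t : Fin (S.num m) → ℕ) :
    S.K m →ₗ[Env k (QuiverAlgebra I)] S.K l :=
  S.extend fun r => x r • S.ε l (t r)

theorem gen_smul_smul_ε {m l : ℕ} {r : Fin (S.num m)} {x : k} {j : ℕ}
    (h : x ≠ 0 → ∃ h : j < S.num l, S.org m r = S.org l ⟨j, h⟩ ∧ S.ter m r = S.ter l ⟨j, h⟩) :
    S.gen m r • x • S.ε l j = x • S.ε l j := by
  by_cases hx : x = 0
  · rw [hx, zero_smul, smul_zero]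
  · obtain ⟨hj, ho, ht⟩ := h hx
    have : S.gen m r = S.gen l ⟨j, hj⟩ := by rw [gen, gen, ho, ht]
    rw [this, smul_comm]
    exact congrArg (x • ·) (S.gen_smul_ε ⟨j, hj⟩)

/-- Equal origins and termini make `gen m r` and `gen (l + 1) j` the same idempotent, so this term
carries the same factor as the other two. For x = 0 the index j may be out of range, and both sides
vanish. -/
theorem smul_d_ε (c : ℕ → ℕ → ℕ → ℕ → ℕ → k) {m l : ℕ} {r : Fin (S.num m)} {x : k} {j : ℕ}
    (h : x ≠ 0 → ∃ h : j < S.num (l + 1),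
      S.org m r = S.org (l + 1) ⟨j, h⟩ ∧ S.ter m r = S.ter (l + 1) ⟨j, h⟩) :
    S.d c (l + 1) l (x • S.ε (l + 1) j) = S.gen m r • ∑ α : Fin (S.num l),
      sideSum k S.arr (fun p => x * c (l + 1) j 1 p α)
        (fun q => x * ((-1) ^ (l + 1) * c (l + 1) j l α q)) (S.ε l α) := by
  by_cases hx : x = 0
  · subst hx
    simp [sideSum]
  · obtain ⟨hj, ho, ht⟩ := h hx
    have hg : S.gen m r = S.gen (l + 1) ⟨j, hj⟩ := by rw [gen, gen, ho, ht]
    rw [hg, LinearMap.map_smul_of_tower]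
    simp only [← smul_sideSum, ← Finset.smul_sum]
    rw [smul_comm]
    exact congrArg (x • ·) (S.d_ε c rfl ⟨j, hj⟩)

/-- The composite of the differential with a monomial map `F`, when the scalars of the differential
in degrees `m` and `l + 1` are compatible along `F`. -/
theorem monomial_d_ε (c : ℕ → ℕ → ℕ → ℕ → ℕ → k) {m m' l : ℕ} (hm : m = m' + 1)
    (F : S.K m' →ₗ[Env k (QuiverAlgebra I)] S.K l) (x : Fin (S.num m') → ℕ → k)
    (t : Fin (S.num m') → ℕ) (hF : ∀ j : Fin (S.num m'), F (S.ε m' j) = x j (t j) • S.ε l (t j))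
    (hx : ∀ j α, x j α ≠ 0 → α = t j ∧ α < S.num l) (r : Fin (S.num m))
    (hcompat : ∀ j : Fin (S.num m'), x j (t j) ≠ 0 →
      (∀ p : Fin (S.num 1), c m r 1 p j = c (l + 1) r 1 p (t j)) ∧
      (∀ q : Fin (S.num 1),
        (-1) ^ m * c m r m' j q = (-1) ^ (l + 1) * c (l + 1) r l (t j) q)) :
    F (S.d c m m' (S.ε m r)) = S.gen m r • ∑ α : Fin (S.num l),
      sideSum k S.arr (fun p => (∑ j, x j α) * c (l + 1) r 1 p α)
        (fun q => (∑ j, x j α) * ((-1) ^ (l + 1) * c (l + 1) r l α q)) (S.ε l α) := by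
  rw [S.d_ε c hm, map_smul, map_sum]
  simp only [← smul_sideSum, Finset.sum_smul, map_sideSum, hF, sideSum_smul]
  -- Exchanging the sums reduces the column sums over j to one j at a time; its row is supported at
  -- α = t j.
  rw [Finset.sum_comm]
  refine congrArg (S.gen m r • ·) (Finset.sum_congr rfl fun j _ => ?_)
  by_cases h : x j (t j) = 0
  · rw [h, zero_smul, Finset.sum_eq_zero]
    intro α _
    have : x j α = 0 := by
      by_contra h'
      exact h' ((hx j α h').1 ▸ h)
    rw [this, zero_smul]
  · rw [Finset.sum_eq_single ⟨t j, (hx j _ h).2⟩]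
    · obtain ⟨h₁, h₂⟩ := hcompat j h
      simp only [h₁, h₂]
    · intro α _ hα
      have : x j α = 0 := by
        by_contra h'
        exact hα (Fin.ext (hx j α h').1)
      rw [this, zero_smul]
    · simp

/-- The commutator with a cochain that takes the value `f 1 w` at one generator and vanishes at
the other ones. -/
theorem commutatorWith_ε_of_single (c : ℕ → ℕ → ℕ → ℕ → ℕ → k) {n : ℕ}
    (η : S.K n →ₗ[Env k (QuiverAlgebra I)] QuiverAlgebra I) (i : Fin (S.num n))
    (w : Fin (S.num 1)) (hηi : η (S.ε n i) = S.arr w)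
    (hη0 : ∀ j : Fin (S.num n), j ≠ i → η (S.ε n j) = 0) (l : ℕ) (r : Fin (S.num (l + n))) :
    commutatorWith (S.Δ c) η l (S.ε (l + n) r) = S.gen (l + n) r • ∑ α : Fin (S.num l),
      sideSum k S.arr (fun p => if p = w then c (l + n) r n i α else 0)
        (fun q => if q = w then (-1) ^ (n * l + 1) * c (l + n) r l α i else 0) (S.ε l α) := by
  rw [commutatorWith_ε]
  refine congrArg (S.gen (l + n) r • ·) ?_
  simp only [sideSum_single, Finset.sum_add_distrib, sub_eq_add_neg]
  congr 1
  · rw [Finset.sum_eq_single i]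
    · simp only [hηi]
    · intro j _ hj
      simp only [hη0 j hj, zero_lact, smul_zero, Finset.sum_const_zero]
    · simp
  · rw [Finset.smul_sum, ← Finset.sum_neg_distrib]
    refine Finset.sum_congr rfl fun α _ => ?_
    rw [Finset.sum_eq_single i]
    -- The exponent n l + 1 combines the Koszul sign with the minus sign of the commutator; the
    -- parity split passes from integer to field scalars.
    · rw [hηi, pow_succ, mul_neg_one, neg_mul, neg_smul, mul_smul]
      rcases Nat.even_or_odd (n * l) with h | h <;> simp [h.neg_one_pow]
    · intro j _ hj
      rw [hη0 j hj, ract_zero, smul_zero]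
    · simp

end LinearResolution

end KoszulLift

/-! ### Comparison of coefficients. -/

theorem mainTheorem3 {k V : Type*} [Field k] [Fintype V] [Quiver V]
    (I : Ideal (KoszulLift.PathAlgebra k V)) [I.IsTwoSided]
    (S : KoszulLift.LinearResolution I)
    (c : ℕ → ℕ → ℕ → ℕ → ℕ → k) (hc : S.IsComultiplication c)
    (n : ℕ)
    (η : S.K n →ₗ[KoszulLift.Env k (KoszulLift.QuiverAlgebra I)]
      (KoszulLift.QuiverAlgebra I))
    (hη : η.comp (S.d c (n + 1) n) = 0)
    (i : Fin (S.num n)) (w : Fin (S.num 1))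
    (hηi : η (S.ε n i) = S.arr w)
    (hη0 : ∀ j : Fin (S.num n), j ≠ i → η (S.ε n j) = 0)
    -- the scalar `b m r l j` is `b_{m,r}(l, j)`, where `l = m - n + 1`
    (s : ℕ → ℕ → ℕ) (b : ℕ → ℕ → ℕ → ℕ → k)
    -- `b_{m,r}(l, j)` vanishes unless `l = m - n + 1` and `j = s`, and the prescription
    -- `ε^m_r ↦ b_{m,r}(l, s) ε^l_s` extends to a bimodule map
    (hb : ∀ (m l : ℕ) (r : Fin (S.num m)) (j : ℕ), b m r l j ≠ 0 →
      m + 1 = l + n ∧ j = s m r ∧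
        ∃ h : j < S.num l, S.org m r = S.org l ⟨j, h⟩ ∧ S.ter m r = S.ter l ⟨j, h⟩)
    -- the map vanishes on `K (n - 1)`
    (hb0 : ∀ (m : ℕ) (r : Fin (S.num m)) (j : ℕ), m + 1 = n → b m r 0 j = 0)
    -- compatibility of the scalars, with `m = l + n` and `j' = s (m - 1) j`
    (hcompat : ∀ (l : ℕ) (r : Fin (S.num (l + n))) (j : Fin (S.num (l + n - 1))),
      b (l + n - 1) j l (s (l + n - 1) j) ≠ 0 →
      (∀ p : Fin (S.num 1),
        c (l + n) r 1 p j = c (l + 1) r 1 p (s (l + n - 1) j)) ∧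
      (∀ q : Fin (S.num 1),
        (-1) ^ (l + n) * c (l + n) r (l + n - 1) j q
          = (-1) ^ (l + 1) * c (l + 1) r l (s (l + n - 1) j) q))
    -- condition (i), with `m = l + n`
    (hB : ∀ (l : ℕ) (r : Fin (S.num (l + n))) (α : Fin (S.num l)) (p : Fin (S.num 1)),
      b (l + n) r (l + 1) (s (l + n) r) * c (l + 1) (s (l + n) r) 1 p α
        + (-1) ^ n * (∑ j : Fin (S.num (l + n - 1)), b (l + n - 1) j l α)
          * c (l + 1) r 1 p α
      = if p = w then c (l + n) r n i α else 0)
    -- condition (ii), with `m = l + n`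
    (hB' : ∀ (l : ℕ) (r : Fin (S.num (l + n))) (α : Fin (S.num l)) (q : Fin (S.num 1)),
      (-1) ^ (l + n + 1) *
        ((-1) ^ n * b (l + n) r (l + 1) (s (l + n) r) * c (l + 1) (s (l + n) r) l α q
          + (∑ j : Fin (S.num (l + n - 1)), b (l + n - 1) j l α) * c (l + 1) r l α q)
      = if q = w then (-1) ^ (n * l + 1) * c (l + n) r l α i else 0) :
    ∃ ψ : ∀ m l, S.K m →ₗ[KoszulLift.Env k (KoszulLift.QuiverAlgebra I)] S.K l,
      (∀ (m l : ℕ) (r : Fin (S.num m)), m + 1 = l + n →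
        ψ m l (S.ε m r) = b m r l (s m r) • S.ε l (s m r)) ∧
      KoszulLift.IsHomotopyLifting (S.d c) S.μ (S.Δ c) η ψ := by
  let ψ : ∀ m l, S.K m →ₗ[KoszulLift.Env k (KoszulLift.QuiverAlgebra I)] S.K l := fun m l =>
    S.monomialMap m l (fun r => b m r l (s m r)) (fun r => s m r)
  have hψ : ∀ (m l : ℕ) (r : Fin (S.num m)),
      ψ m l (S.ε m r) = b m r l (s m r) • S.ε l (s m r) := fun m l r =>
    (S.extend_ε _ r).trans (S.gen_smul_smul_ε fun h => (hb m l r _ h).2.2)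
  -- The witness 0 is the homotopy φ, available because the diagonal is strictly counital.
  refine ⟨ψ, fun m l r _ => hψ m l r, ⟨fun l => S.hom_ext fun r => ?_, 0, fun m => ?_, ?_⟩⟩
  · have hψd : ψ (l + n - 1) l (S.d c (l + n) (l + n - 1) (S.ε (l + n) r))
        = S.gen (l + n) r • ∑ α : Fin (S.num l), KoszulLift.sideSum k S.arr
          (fun p => (∑ j : Fin (S.num (l + n - 1)), b (l + n - 1) j l α) * c (l + 1) r 1 p α)
          (fun q => (∑ j : Fin (S.num (l + n - 1)), b (l + n - 1) j l α) *
            ((-1) ^ (l + 1) * c (l + 1) r l α q)) (S.ε l α) := by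
      -- For l = n = 0 the truncated degree l + n - 1 is 0 instead of -1. There the differential is
      -- zero by definition, and the scalars b vanish by their degree condition.
      rcases Nat.eq_zero_or_pos (l + n) with h | h
      · have hB0 : ∀ (j : Fin (S.num (l + n - 1))) (α : ℕ), b (l + n - 1) j l α = 0 := by
          intro j α
          by_contra h'
          have := (hb _ _ j α h').1
          omega
        rw [S.d_of_ne c (by omega)]
        simp [hB0, KoszulLift.sideSum]
      · exact S.monomial_d_ε c (by omega) _ (fun j α => b (l + n - 1) j l α)
          (fun j => s (l + n - 1) j) (hψ _ _)
          (fun j α h' => ⟨(hb _ _ j α h').2.1, (hb _ _ j α h').2.2.1⟩) r (hcompat l r)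
    rw [S.commutatorWith_ε_of_single c η i w hηi hη0, LinearMap.sub_apply, LinearMap.smul_apply,
      LinearMap.comp_apply, LinearMap.comp_apply, hψ, hψd,
      S.smul_d_ε c fun h => (hb _ _ r _ h).2.2]
    have hsign : ∀ z : S.K l, -((-1 : ℤ) ^ (n + 1) • z) = (-1 : k) ^ n • z := by
      intro z
      rcases Nat.even_or_odd n with h | h <;>
        simp [pow_succ, h.neg_one_pow]
    rw [sub_eq_add_neg, hsign, smul_comm, ← smul_add, Finset.smul_sum, ← Finset.sum_add_distrib]
    refine congrArg (S.gen (l + n) r • ·) (Finset.sum_congr rfl fun α _ => ?_)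
    rw [KoszulLift.smul_sideSum, KoszulLift.sideSum_add]
    congr 1
    · funext p
      rw [← hB l r α p]
      ring
    · funext q
      rw [← hB' l r α q]
      have hn : ((-1 : k) ^ n) * (-1) ^ n = 1 := by rw [← mul_pow]; simp
      -- The outer sign of (ii) splits as (-1)^n (-1)^(l+1); in the term with b_{m,r} its (-1)^n
      -- meets the inner one, and `hn` cancels the two.
      rw [show l + n + 1 = n + (l + 1) by omega, pow_add (-1 : k) n]
      linear_combination (-(-1 : k) ^ (l + 1) * b (l + n) r (l + 1) (s (l + n) r) *
        c (l + 1) (s (l + n) r) l α q) * hn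
  · rw [KoszulLift.LinearResolution.commutatorWith_μ hc]
    simp
  · intro m hm
    -- With φ = 0 and ψ = 0 on K_{n-1}, the difference is itself zero, so it is the coboundary of 0.
    refine ⟨0, S.hom_ext fun r => ?_⟩
    simp [hψ, hb0 m r _ hm]
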